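/- All trees are finite. A leaf of a tree is a vertex of degree one; the other vertices are internal. A stem is a vertex of degree at least two that is adjacent to a leaf; it is weak if it is adjacent to exactly one leaf, and exposed if at most one of its neighbours is an internal vertex. Operation EWS, applied to a tree, deletes an exposed weak stem together with the leaf adjacent to it; it is also applicable to the path $P_3$ on three vertices, where it deletes the centre and one of the two leaves (leaving $K_1$). For a graph $G$, $\beta(G)$ is the independence number. A set $D$ of vertices is an $m$-eternal dominating set of $G$ if guards placed on the vertices of $D$, one on each, can answer every infinite sequence of attacks under the following rules: each attack is on a vertex $r$ without a guard and may depend on the current positions of the guards; in response all guards move simultaneously, each staying or going to an adjacent vertex, so that no vertex holds more than one guard and $r$ holds one; and the set of occupied vertices is a dominating set at all times. The smallest size of an $m$-eternal dominating set is $\gamma_{\mathrm m}^{\infty}(G)$. Theorem. Let $T$ be a tree with at least two vertices. Then $\gamma_{\mathrm m}^{\infty}(T)=\beta(T)$ if and only if repeated applications of operation EWS reduce $T$ to $K_1$ or $K_2$. Here it does not matter how the applications are chosen: $\gamma_{\mathrm m}^{\infty}(T)=\beta(T)$ holds if and only if some finite (possibly empty) sequence of applications of EWS leads from $T$ to $K_1$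 or $K_2$, and it holds if and only if every sequence of applications of EWS starting from $T$ and continued until EWS is no longer applicable ends in $K_1$ or $K_2$. -/

import Mathlib

namespace EternalDomination

variable {V : Type*}

/-- `D` is a dominating set of `G`: every vertex outside `D` has a neighbour in `D`. -/
def IsDominating (G : SimpleGraph V) (D : Finset V) : Prop :=
  ∀ u, u ∉ D → ∃ x ∈ D, G.Adj x u

/-- The guards standing on `D` (one per vertex) can be moved simultaneously, each one staying where
it is or going to an adjacent vertex, so that afterwards they stand on `D'` (one per vertex):
`f` gives the new location of each guard. -/
def CanMove (G : SimpleGraph V) (D D' : Finset V) : Prop :=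
  ∃ f : V → V, (∀ v ∈ D, f v = v ∨ G.Adj v (f v)) ∧ Set.BijOn f (D : Set V) (D' : Set V)

/-- `D` is an `m`-eternal dominating set: starting with guards on `D`, the defender can answer every
infinite sequence of attacks (each at an unoccupied vertex `r`) by moving guards so that `r` becomes
occupied and every configuration that occurs is dominating. Equivalently, `D` lies in a family `F`
of configurations (those the defender is prepared to use) which the defender never has to leave. -/
def IsMEternalDominating (G : SimpleGraph V) (D : Finset V) : Prop :=
  ∃ F : Set (Finset V), D ∈ F ∧
    (∀ C ∈ F, IsDominating G C) ∧
    (∀ C ∈ F, ∀ r, r ∉ C → ∃ C' ∈ F, r ∈ C' ∧ CanMove G C C')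

/-- The `m`-eternal domination number: the smallest size of an `m`-eternal dominating set.
For a finite graph the whole vertex set is such a set, so the infimum is attained. -/
noncomputable def mEternalDominationNumber (G : SimpleGraph V) : ℕ :=
  sInf {k : ℕ | ∃ D : Finset V, IsMEternalDominating G D ∧ D.card = k}

/-- A leaf is a vertex of degree one. -/
def IsLeaf (G : SimpleGraph V) (v : V) : Prop :=
  (G.neighborSet v).encard = 1

/-- A stem is a vertex of degree at least two that is adjacent to a leaf. -/
def IsStem (G : SimpleGraph V) (s : V) : Prop :=
  2 ≤ (G.neighborSet s).encard ∧ ∃ l, G.Adj s l ∧ IsLeaf G l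

/-- A weak stem is a stem adjacent to exactly one leaf. -/
def IsWeakStem (G : SimpleGraph V) (s : V) : Prop :=
  IsStem G s ∧ {l | G.Adj s l ∧ IsLeaf G l}.encard = 1

/-- A stem is exposed if it has at most one internal (that is, non-leaf) neighbour. -/
def IsExposedStem (G : SimpleGraph V) (s : V) : Prop :=
  IsStem G s ∧ {v | G.Adj s v ∧ ¬ IsLeaf G v}.encard ≤ 1

/-- One application of operation EWS, going from the subtree induced by `S` to the subtree induced
by `S'`: an exposed weak stem `s` and its leaf `l` are deleted. The operation also applies to a path
on three vertices, where it deletes the centre and one of the two leaves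
(a graph with exactly three vertices that has a stem is a path on three vertices). -/
def EWSStep (G : SimpleGraph V) (S S' : Set V) : Prop :=
  ∃ s l : S, IsExposedStem (G.induce S) s ∧
    (IsWeakStem (G.induce S) s ∨ S.encard = 3) ∧
    (G.induce S).Adj s l ∧ IsLeaf (G.induce S) l ∧
    S' = S \ {(s : V), (l : V)}

/-- Finitely many (possibly zero) applications of operation EWS to `G` can lead to the subgraph
induced by `S`. -/
def EWSReducesTo (G : SimpleGraph V) (S : Set V) : Prop :=
  Relation.ReflTransGen (EWSStep G) Set.univ S

/-- The subgraph of `G` induced by `S` is (isomorphic to) `K_1` or `K_2`. -/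
def IsK1OrK2 (G : SimpleGraph V) (S : Set V) : Prop :=
  Nonempty (G.induce S ≃g (⊤ : SimpleGraph (Fin 1))) ∨
    Nonempty (G.induce S ≃g (⊤ : SimpleGraph (Fin 2)))

end EternalDomination

namespace EternalDomination

section Trees

variable {W : Type*} {G : SimpleGraph W}

theorem eq_of_adj_of_dist_lt (hG : G.IsTree) {v a b c : W} (hb : G.Adj a b) (hc : G.Adj a c)
    (hbv : G.dist v b < G.dist v a) (hcv : G.dist v c < G.dist v a) : b = c := by
  obtain ⟨p, hp, hpl⟩ := hG.connected.exists_path_of_dist b v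
  obtain ⟨q, hq, hql⟩ := hG.connected.exists_path_of_dist c v
  have key : ∀ {d : W} (r : G.Walk d v), r.length = G.dist d v → G.dist v d < G.dist v a →
      a ∉ r.support := by
    classical
    intro d r hr hd ha
    have h1 := SimpleGraph.dist_le (r.dropUntil a ha)
    have h2 := r.length_dropUntil_le_length ha
    rw [SimpleGraph.dist_comm (u := v), SimpleGraph.dist_comm (u := v) (v := a)] at hd
    omega
  have hP : (SimpleGraph.Walk.cons hb p).IsPath := hp.cons (key p hpl hbv)
  have hQ : (SimpleGraph.Walk.cons hc q).IsPath := hq.cons (key q hql hcv)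
  have h := (hG.existsUnique_path a v).unique hP hQ
  simpa using congrArg SimpleGraph.Walk.snd h

theorem exists_adj_dist_add_one (hG : G.IsTree) {v u : W} (h : v ≠ u) :
    ∃ x, G.Adj x u ∧ G.dist v x + 1 = G.dist v u := by
  obtain ⟨p, hp⟩ := hG.connected.exists_walk_length_eq_dist u v
  cases p with
  | nil => exact absurd rfl h
  | @cons _ x _ hux q =>
    refine ⟨x, hux.symm, ?_⟩
    have h1 := SimpleGraph.dist_le q
    have h2 := hux.diff_dist_adj (u := v)
    rw [SimpleGraph.Walk.length_cons] at hp
    rw [SimpleGraph.dist_comm] at h1 hp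
    omega

theorem isLeaf_iff_forall {x l : W} (h : G.Adj l x) : IsLeaf G l ↔ ∀ w, G.Adj l w → w = x := by
  rw [IsLeaf, Set.encard_eq_one]
  constructor
  · rintro ⟨y, hy⟩ w hw
    have h1 : w ∈ G.neighborSet l := hw
    have h2 : x ∈ G.neighborSet l := h
    rw [hy] at h1 h2
    exact h1.trans h2.symm
  · intro hl
    exact ⟨x, Set.ext fun w => ⟨hl w, fun hw => by rw [Set.mem_singleton_iff.1 hw]; exact h⟩⟩

theorem isLeaf_of_forall_dist_le (hG : G.IsTree) {v u x : W} (hu : ∀ w, G.dist v w ≤ G.dist v u)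
    (hx : G.Adj u x) : IsLeaf G u := by
  rw [isLeaf_iff_forall hx]
  intro w hw
  exact eq_of_adj_of_dist_lt hG hw hx
    (lt_of_le_of_ne (hu w) (hG.dist_ne_of_adj v hw).symm)
    (lt_of_le_of_ne (hu x) (hG.dist_ne_of_adj v hx).symm)

theorem isStem_of_adj {x l m : W} (hl : G.Adj x l) (hm : G.Adj x m) (h : l ≠ m)
    (hleaf : IsLeaf G l) : IsStem G x := by
  refine ⟨?_, l, hl, hleaf⟩
  have : 1 < (G.neighborSet x).encard := Set.one_lt_encard_iff.2 ⟨l, m, hl, hm, h⟩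
  have := Order.add_one_le_of_lt this
  rwa [one_add_one_eq_two] at this

theorem exists_isExposedStem_of_dist (hG : G.IsTree) {v u : W}
    (hu : ∀ w, G.dist v w ≤ G.dist v u) (h2 : 2 ≤ G.dist v u) :
    ∃ x, G.Adj x u ∧ G.dist v x + 1 = G.dist v u ∧ IsExposedStem G x := by
  obtain ⟨x, hxu, hx⟩ := exists_adj_dist_add_one hG (v := v) (u := u) (by rintro rfl; simp at h2)
  obtain ⟨y, hyx, hy⟩ := exists_adj_dist_add_one hG (v := v) (u := x) (by rintro rfl; simp at hx; omega)
  have hul := isLeaf_of_forall_dist_le hG hu hxu.symm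
  refine ⟨x, hxu, hx, isStem_of_adj hxu hyx.symm (by rintro rfl; omega) hul, ?_⟩
  have key : ∀ w, G.Adj x w → ¬ IsLeaf G w → G.dist v w < G.dist v x := by
    intro w hxw hw
    by_contra hlt
    refine hw (isLeaf_of_forall_dist_le (v := v) hG (fun z => ?_) hxw.symm)
    have h3 := hG.dist_ne_of_adj v hxw
    have h4 := hu z
    omega
  rw [Set.encard_le_one_iff]
  rintro a b ⟨ha, ha'⟩ ⟨hb, hb'⟩
  exact eq_of_adj_of_dist_lt hG ha hb (key a ha ha') (key b hb hb')

theorem isExposedStem_of_star {x a b : W} (hx : ∀ w, w ≠ x → G.Adj x w ∧ IsLeaf G w)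
    (ha : a ≠ x) (hb : b ≠ x) (hab : a ≠ b) : IsExposedStem G x := by
  refine ⟨isStem_of_adj (hx a ha).1 (hx b hb).1 hab (hx a ha).2, ?_⟩
  rw [Set.encard_le_one_iff]
  rintro c _ ⟨hc, hc'⟩
  exact absurd (hx c hc.ne').2 hc'

theorem star_or_exists_two_exposed [Finite W] (hG : G.IsTree) :
    (∃ x, ∀ w, w ≠ x → G.Adj x w ∧ IsLeaf G w) ∨
      ∃ x y, x ≠ y ∧ IsExposedStem G x ∧ IsExposedStem G y := by
  have far : ∀ v, ∃ u, ∀ w, G.dist v w ≤ G.dist v u := fun v =>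
    have := hG.connected.nonempty
    Finite.exists_max (G.dist v)
  obtain ⟨v⟩ := hG.connected.nonempty
  obtain ⟨u, hu⟩ := far v
  by_cases h2 : 2 ≤ G.dist v u
  · obtain ⟨x, hxu, -, hx⟩ := exists_isExposedStem_of_dist hG hu h2
    have hul := isLeaf_of_forall_dist_le hG hu hxu.symm
    obtain ⟨w, hw⟩ := far u
    by_cases h3 : 3 ≤ G.dist u w
    · obtain ⟨y, -, hyd, hy⟩ := exists_isExposedStem_of_dist hG hw (by omega)
      refine Or.inr ⟨x, y, ?_, hx, hy⟩
      rintro rfl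
      have := SimpleGraph.dist_eq_one_iff_adj.2 hxu.symm
      omega
    · refine Or.inl ⟨x, fun z hz => ?_⟩
      by_cases hzu : u = z
      · exact hzu ▸ ⟨hxu, hul⟩
      obtain ⟨y, hyz, hy⟩ := exists_adj_dist_add_one hG hzu
      have hzw := hw z
      by_cases huy : u = y
      · subst huy
        exact absurd ((isLeaf_iff_forall hxu.symm).1 hul z hyz) hz
      have hy0 : 0 < G.dist u y := hG.connected.pos_dist_of_ne huy
      have hyx := (isLeaf_iff_forall hxu.symm).1 hul y
        (SimpleGraph.dist_eq_one_iff_adj.1 (by omega))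
      subst hyx
      exact ⟨hyz, isLeaf_of_forall_dist_le (v := u) hG (fun t => by have := hw t; omega) hyz.symm⟩
  · refine Or.inl ⟨v, fun w hw => ?_⟩
    have h0 : 0 < G.dist v w := hG.connected.pos_dist_of_ne hw.symm
    have h1 := hu w
    have hvw : G.Adj v w := SimpleGraph.dist_eq_one_iff_adj.1 (by omega)
    exact ⟨hvw, isLeaf_of_forall_dist_le (v := v) hG (fun t => by have := hu t; omega) hvw.symm⟩

theorem exists_isExposedStem [Fintype W] (hG : G.IsTree) (h3 : 3 ≤ Fintype.card W) :
    ∃ x, IsExposedStem G x := by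
  obtain ⟨x, hx⟩ | ⟨x, -, -, hx, -⟩ := star_or_exists_two_exposed hG
  · classical
    have : 1 < (Finset.univ.erase x).card := by
      rw [Finset.card_erase_of_mem (Finset.mem_univ _), Finset.card_univ]; omega
    obtain ⟨a, ha, b, hb, hab⟩ := Finset.one_lt_card.1 this
    exact ⟨x, isExposedStem_of_star hx (Finset.ne_of_mem_erase ha) (Finset.ne_of_mem_erase hb) hab⟩
  · exact ⟨x, hx⟩

theorem exists_indepSet_card_le [Fintype W] [DecidableEq W] (hG : G.Colorable 2)
    (R : Finset W) : ∃ J ⊆ R, (∀ a ∈ J, ∀ b ∈ J, ¬ G.Adj a b) ∧ R.card ≤ 2 * J.card := by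
  obtain ⟨c⟩ := hG
  have h := Finset.card_filter_add_card_filter_not (s := R) (fun w => c w = 0)
  by_cases hc : R.card ≤ 2 * (R.filter (fun w => c w = 0)).card
  · refine ⟨_, Finset.filter_subset _ _, fun a ha b hb hab => c.valid hab ?_, hc⟩
    rw [(Finset.mem_filter.1 ha).2, (Finset.mem_filter.1 hb).2]
  · refine ⟨R.filter (fun w => ¬ c w = 0), Finset.filter_subset _ _,
      fun a ha b hb hab => c.valid hab ?_, by omega⟩
    have h1 := (Finset.mem_filter.1 ha).2
    have h2 := (Finset.mem_filter.1 hb).2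
    omega

theorem exists_large_indepSet_of_card_le [Fintype W] [DecidableEq W] (hG : G.Colorable 2)
    {L X : Finset W} (hLX : Disjoint L X) (hL : ∀ a ∈ L, ∀ w, G.Adj a w → w ∈ X)
    (hc : X.card + 2 ≤ L.card) :
    ∃ I : Finset W, (∀ a ∈ I, ∀ b ∈ I, ¬ G.Adj a b) ∧ Fintype.card W + 2 ≤ 2 * I.card := by
  obtain ⟨J, hJ, hJi, hJc⟩ := exists_indepSet_card_le hG (L ∪ X)ᶜ
  have hJ' : ∀ a ∈ J, a ∉ L ∧ a ∉ X := fun a ha => by simpa using hJ ha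
  refine ⟨L ∪ J, ?_, ?_⟩
  · have hLJ : ∀ a ∈ L, ∀ b ∈ L ∪ J, ¬ G.Adj a b := by
      intro a ha b hb hab
      have hbX := hL a ha b hab
      rcases Finset.mem_union.1 hb with hb | hb
      · exact Finset.disjoint_left.1 hLX hb hbX
      · exact (hJ' b hb).2 hbX
    intro a ha b hb hab
    rcases Finset.mem_union.1 ha with ha' | ha'
    · exact hLJ a ha' b hb hab
    · rcases Finset.mem_union.1 hb with hb' | hb'
      · exact hLJ b hb' a ha hab.symm
      · exact hJi a ha' b hb' hab
  · rw [Finset.card_union_of_disjoint (Finset.disjoint_left.2 fun a ha haJ => (hJ' a haJ).1 ha)]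
    rw [Finset.card_compl, Finset.card_union_of_disjoint hLX] at hJc
    omega

theorem not_isLeaf_of_isStem {x : W} (h : IsStem G x) : ¬ IsLeaf G x := by
  intro hl
  have h1 := h.1
  rw [hl] at h1
  exact absurd h1 (by norm_num)

theorem exists_large_indepSet [Fintype W] (hG : G.IsTree) (h4 : 4 ≤ Fintype.card W)
    (hs : ∀ x, IsExposedStem G x →
      ∃ a b, a ≠ b ∧ (G.Adj x a ∧ IsLeaf G a) ∧ G.Adj x b ∧ IsLeaf G b) :
    ∃ I : Finset W, (∀ a ∈ I, ∀ b ∈ I, ¬ G.Adj a b) ∧ Fintype.card W + 2 ≤ 2 * I.card := by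
  classical
  obtain ⟨x, hx⟩ | ⟨x, y, hxy, hx, hy⟩ := star_or_exists_two_exposed hG
  · refine exists_large_indepSet_of_card_le hG.colorable_two (L := Finset.univ.erase x) (X := {x})
      (by simp) (fun a ha w haw => ?_) ?_
    · have h := hx a (Finset.ne_of_mem_erase ha)
      exact Finset.mem_singleton.2 ((isLeaf_iff_forall h.1.symm).1 h.2 w haw)
    · rw [Finset.card_erase_of_mem (Finset.mem_univ _), Finset.card_univ, Finset.card_singleton]
      omega
  · obtain ⟨a, b, hab, ⟨hxa, ha⟩, hxb, hb⟩ := hs x hx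
    obtain ⟨c, d, hcd, ⟨hyc, hc⟩, hyd, hd⟩ := hs y hy
    have hxl := not_isLeaf_of_isStem hx.1
    have hyl := not_isLeaf_of_isStem hy.1
    have ne : ∀ {p q : W}, IsLeaf G q → G.Adj x p → G.Adj y q → p ≠ q := by
      rintro p _ hq hxp hyp rfl
      exact hxy ((isLeaf_iff_forall hyp.symm).1 hq x hxp.symm)
    have hac := ne hc hxa hyc
    have had := ne hd hxa hyd
    have hbc := ne hc hxb hyc
    have hbd := ne hd hxb hyd
    refine exists_large_indepSet_of_card_le hG.colorable_two (L := {a, b, c, d}) (X := {x, y})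
      ?_ ?_ ?_
    · rw [Finset.disjoint_left]
      simp only [Finset.mem_insert, Finset.mem_singleton]
      rintro z (rfl | rfl | rfl | rfl) (rfl | rfl) <;> contradiction
    · simp only [Finset.mem_insert, Finset.mem_singleton]
      rintro z (rfl | rfl | rfl | rfl) w hw
      · exact Or.inl ((isLeaf_iff_forall hxa.symm).1 ha w hw)
      · exact Or.inl ((isLeaf_iff_forall hxb.symm).1 hb w hw)
      · exact Or.inr ((isLeaf_iff_forall hyc.symm).1 hc w hw)
      · exact Or.inr ((isLeaf_iff_forall hyd.symm).1 hd w hw)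
    · rw [Finset.card_pair hxy, Finset.card_insert_of_notMem (by simp [hab, hac, had]),
        Finset.card_insert_of_notMem (by simp [hbc, hbd]), Finset.card_pair hcd]

end Trees

section Strategies

variable {V : Type*} {G : SimpleGraph V}

theorem CanMove.refl (C : Finset V) : CanMove G C C :=
  ⟨id, fun _ _ => Or.inl rfl, Set.bijOn_id _⟩

theorem CanMove.insert [DecidableEq V] {C D : Finset V} (h : CanMove G C D) {a b : V}
    (ha : a ∉ C) (hb : b ∉ D) (hab : b = a ∨ G.Adj a b) :
    CanMove G (insert a C) (insert b D) := by
  obtain ⟨f, hf, hbij⟩ := h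
  have hne : ∀ v ∈ C, Function.update f a b v = f v := fun v hv =>
    Function.update_of_ne (by rintro rfl; exact ha hv) _ _
  refine ⟨Function.update f a b, fun v hv => ?_, ?_⟩
  · rcases Finset.mem_insert.1 hv with rfl | hv
    · simpa using hab
    · rw [hne v hv]; exact hf v hv
  · have h1 : Set.BijOn (Function.update f a b) (C : Set V) D :=
      hbij.congr fun v hv => (hne v hv).symm
    have h2 := h1.insert (a := a) (by simpa using hb)
    simpa using h2

/-- A family of `k`-element configurations inside `S` that the defender never has to leave when
the attacks are on vertices of `S`. -/
def Defends (G : SimpleGraph V) (S : Set V) (k : ℕ) : Prop :=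
  ∃ F : Set (Finset V), F.Nonempty ∧ (∀ C ∈ F, (C : Set V) ⊆ S ∧ C.card = k) ∧
    ∀ C ∈ F, ∀ r ∈ S, r ∉ C → ∃ D ∈ F, r ∈ D ∧ CanMove G C D

theorem defends_one_of_clique {S : Set V} (hS : S.Nonempty)
    (h : ∀ a ∈ S, ∀ b ∈ S, a ≠ b → G.Adj a b) : Defends G S 1 := by
  classical
  obtain ⟨u, hu⟩ := hS
  refine ⟨{C | ∃ v ∈ S, C = {v}}, ⟨{u}, u, hu, rfl⟩, ?_, ?_⟩
  · rintro _ ⟨v, hv, rfl⟩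
    simpa using hv
  · rintro _ ⟨v, hv, rfl⟩ r hr hrv
    refine ⟨{r}, ⟨r, hr, rfl⟩, Finset.mem_singleton_self r, ?_⟩
    exact (CanMove.refl ∅).insert (Finset.notMem_empty _) (Finset.notMem_empty _)
      (Or.inr (h v hv r hr (by simpa [eq_comm] using hrv)))

theorem Defends.add_edge {S : Set V} {x l : V} {k : ℕ} (hx : x ∈ S) (hl : l ∈ S)
    (hxl : G.Adj x l) (h : Defends G (S \ {x, l}) k) : Defends G S (k + 1) := by
  classical
  obtain ⟨F, ⟨C₀, hC₀⟩, hF, hmove⟩ := h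
  have hnot : ∀ C ∈ F, ∀ p, p = x ∨ p = l → p ∉ C := fun C hC p hp hpC =>
    ((hF C hC).1 hpC).2 (by simpa using hp)
  refine ⟨{C | ∃ D ∈ F, ∃ p, (p = x ∨ p = l) ∧ C = insert p D},
    ⟨_, C₀, hC₀, x, Or.inl rfl, rfl⟩, ?_, ?_⟩
  · rintro _ ⟨D, hD, p, hp, rfl⟩
    refine ⟨?_, by rw [Finset.card_insert_of_notMem (hnot D hD p hp), (hF D hD).2]⟩
    rw [Finset.coe_insert, Set.insert_subset_iff]
    exact ⟨by rcases hp with rfl | rfl <;> assumption, (hF D hD).1.trans Set.sdiff_subset⟩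
  · rintro _ ⟨D, hD, p, hp, rfl⟩ r hr hrD
    by_cases hr' : r = x ∨ r = l
    · refine ⟨_, ⟨D, hD, r, hr', rfl⟩, Finset.mem_insert_self _ _,
        (CanMove.refl D).insert (hnot D hD p hp) (hnot D hD r hr') ?_⟩
      rcases hp with rfl | rfl <;> rcases hr' with rfl | rfl
      exacts [Or.inl rfl, Or.inr hxl, Or.inr hxl.symm, Or.inl rfl]
    · obtain ⟨E, hE, hrE, hDE⟩ := hmove D hD r ⟨hr, by simpa using hr'⟩
        (fun h => hrD (Finset.mem_insert_of_mem h))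
      exact ⟨_, ⟨E, hE, p, hp, rfl⟩, Finset.mem_insert_of_mem hrE,
        hDE.insert (hnot D hD p hp) (hnot E hE p hp) (Or.inl rfl)⟩

theorem Defends.add_neighbors {S L : Set V} {x : V} {k : ℕ} (hx : x ∈ S) (hLS : L ⊆ S)
    (hL : L.Nonempty) (hxL : ∀ a ∈ L, G.Adj x a) (h : Defends G (S \ L) k) :
    Defends G S (k + 1) := by
  classical
  obtain ⟨F, ⟨C₀, hC₀⟩, hF, hmove⟩ := h
  obtain ⟨a₀, ha₀⟩ := hL
  have hxL' : x ∉ L := fun h => (hxL x h).ne rfl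
  have hnot : ∀ C ∈ F, ∀ p ∈ L, p ∉ C := fun C hC p hp hpC => ((hF C hC).1 hpC).2 hp
  let P : Finset V → V → Prop := fun D p => (x ∉ D ∧ p = x) ∨ (x ∈ D ∧ p ∈ L)
  have hPn : ∀ D ∈ F, ∀ p, P D p → p ∉ D := by
    rintro D hD p (⟨h, rfl⟩ | ⟨-, h⟩)
    exacts [h, hnot D hD p h]
  have hPe : ∀ D, ∃ p, P D p := fun D => by
    by_cases h : x ∈ D
    exacts [⟨a₀, Or.inr ⟨h, ha₀⟩⟩, ⟨x, Or.inl ⟨h, rfl⟩⟩]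
  have key : ∀ D ∈ F, ∀ p, P D p → ∀ E ∈ F, CanMove G D E →
      ∃ q, P E q ∧ CanMove G (insert p D) (insert q E) := by
    intro D hD p hp E hE hDE
    obtain ⟨q, hq, hqa⟩ : ∃ q, P E q ∧ (q = p ∨ G.Adj p q) := by
      rcases hp with ⟨-, hpx⟩ | ⟨-, hpL⟩ <;> by_cases hxE : x ∈ E
      · exact ⟨a₀, Or.inr ⟨hxE, ha₀⟩, Or.inr (hpx ▸ hxL _ ha₀)⟩
      · exact ⟨p, Or.inl ⟨hxE, hpx⟩, Or.inl rfl⟩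
      · exact ⟨p, Or.inr ⟨hxE, hpL⟩, Or.inl rfl⟩
      · exact ⟨x, Or.inl ⟨hxE, rfl⟩, Or.inr (hxL _ hpL).symm⟩
    exact ⟨q, hq, hDE.insert (hPn D hD p hp) (hPn E hE q hq) hqa⟩
  obtain ⟨p₀, hp₀⟩ := hPe C₀
  refine ⟨{C | ∃ D ∈ F, ∃ p, P D p ∧ C = insert p D}, ⟨_, C₀, hC₀, p₀, hp₀, rfl⟩, ?_, ?_⟩
  · rintro _ ⟨D, hD, p, hp, rfl⟩
    refine ⟨?_, by rw [Finset.card_insert_of_notMem (hPn D hD p hp), (hF D hD).2]⟩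
    rw [Finset.coe_insert, Set.insert_subset_iff]
    refine ⟨?_, (hF D hD).1.trans Set.sdiff_subset⟩
    rcases hp with ⟨-, rfl⟩ | ⟨-, hpL⟩
    exacts [hx, hLS hpL]
  · rintro _ ⟨D, hD, p, hp, rfl⟩ r hr hrD
    by_cases hrL : r ∈ L
    · rcases hp with ⟨hxD, rfl⟩ | ⟨hxD, hpL⟩
      · obtain ⟨E, hE, hpE, hDE⟩ := hmove D hD p ⟨hx, hxL'⟩ hxD
        exact ⟨_, ⟨E, hE, r, Or.inr ⟨hpE, hrL⟩, rfl⟩, Finset.mem_insert_self _ _,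
          hDE.insert hxD (hnot E hE r hrL) (Or.inr (hxL r hrL))⟩
      · refine ⟨_, ⟨D, hD, r, Or.inr ⟨hxD, hrL⟩, rfl⟩, Finset.mem_insert_self _ _, ?_⟩
        have hxp := (hxL p hpL).ne
        have hxr := (hxL r hrL).ne
        have h1 : CanMove G (insert p (D.erase x)) (insert x (D.erase x)) :=
          (CanMove.refl _).insert (fun h => hnot D hD p hpL (Finset.mem_of_mem_erase h))
            (Finset.notMem_erase x D) (Or.inr (hxL p hpL).symm)
        have h2 : CanMove G (insert x (insert p (D.erase x))) (insert r (insert x (D.erase x))) :=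
          h1.insert (by simp [hxp]) (by simp [hxr.symm, hnot D hD r hrL]) (Or.inr (hxL r hrL))
        rwa [Finset.insert_comm, Finset.insert_erase hxD] at h2
    · obtain ⟨E, hE, hrE, hDE⟩ := hmove D hD r ⟨hr, hrL⟩
        (fun h => hrD (Finset.mem_insert_of_mem h))
      obtain ⟨q, hq, hm⟩ := key D hD p hp E hE hDE
      exact ⟨_, ⟨E, hE, q, hq, rfl⟩, Finset.mem_insert_of_mem hrE, hm⟩

theorem Defends.exists_isMEternalDominating {k : ℕ} (h : Defends G Set.univ k) :
    ∃ D : Finset V, IsMEternalDominating G D ∧ D.card = k := by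
  obtain ⟨F, ⟨C₀, hC₀⟩, hF, hmove⟩ := h
  refine ⟨C₀, ⟨F, hC₀, fun C hC u hu => ?_, fun C hC r hr => hmove C hC r (Set.mem_univ r) hr⟩,
    (hF C₀ hC₀).2⟩
  obtain ⟨D, -, huD, f, hf, hbij⟩ := hmove C hC u (Set.mem_univ u) hu
  obtain ⟨v, hv, rfl⟩ := hbij.surjOn huD
  refine ⟨v, hv, (hf v hv).resolve_left fun h => hu ?_⟩
  rwa [h]

/-- Guards indexed by `ι`, several of which may share a vertex, can answer every sequence of
attacks on vertices of `S` without leaving `S`. -/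
def RelaxedDefends (G : SimpleGraph V) (S : Set V) (ι : Type*) : Prop :=
  ∃ F : Set (ι → V), F.Nonempty ∧ ∀ p ∈ F, (∀ i, p i ∈ S) ∧
    ∀ r ∈ S, ∃ q ∈ F, (∃ i, q i = r) ∧ ∀ i, p i = q i ∨ G.Adj (p i) (q i)

theorem RelaxedDefends.congr {S : Set V} {ι κ : Type*} (e : κ ≃ ι) (h : RelaxedDefends G S ι) :
    RelaxedDefends G S κ := by
  obtain ⟨F, ⟨p₀, hp₀⟩, hF⟩ := h
  refine ⟨{p | ∃ q ∈ F, p = q ∘ e}, ⟨_, p₀, hp₀, rfl⟩, ?_⟩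
  rintro _ ⟨p, hp, rfl⟩
  refine ⟨fun i => (hF p hp).1 _, fun r hr => ?_⟩
  obtain ⟨q, hq, ⟨i, hi⟩, hm⟩ := (hF p hp).2 r hr
  exact ⟨_, ⟨q, hq, rfl⟩, ⟨e.symm i, by simpa using hi⟩, fun j => hm (e j)⟩

theorem RelaxedDefends.nonempty {S : Set V} {ι : Type*} (h : RelaxedDefends G S ι)
    (hS : S.Nonempty) : Nonempty ι := by
  obtain ⟨F, ⟨p₀, hp₀⟩, hF⟩ := h
  obtain ⟨r, hr⟩ := hS
  obtain ⟨q, -, ⟨i, -⟩, -⟩ := (hF p₀ hp₀).2 r hr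
  exact ⟨i⟩

theorem IsMEternalDominating.relaxedDefends {D : Finset V} (h : IsMEternalDominating G D) :
    RelaxedDefends G Set.univ (Fin D.card) := by
  obtain ⟨F, hDF, -, hmove⟩ := h
  refine RelaxedDefends.congr D.equivFin.symm ⟨{p | ∃ C ∈ F, ∀ v, v ∈ C ↔ ∃ i, p i = v},
    ⟨Subtype.val, D, hDF, fun v => by simp⟩, ?_⟩
  rintro p ⟨C, hC, hpC⟩
  refine ⟨fun i => Set.mem_univ _, fun r _ => ?_⟩
  by_cases hr : r ∈ C
  · exact ⟨p, ⟨C, hC, hpC⟩, (hpC r).1 hr, fun i => Or.inl rfl⟩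
  · obtain ⟨E, hE, hrE, f, hf, hbij⟩ := hmove C hC r hr
    have hfE : ∀ v, v ∈ E ↔ ∃ i, (f ∘ p) i = v := fun v => by
      constructor
      · intro hv
        obtain ⟨w, hw, rfl⟩ := hbij.surjOn hv
        obtain ⟨i, rfl⟩ := (hpC w).1 hw
        exact ⟨i, rfl⟩
      · rintro ⟨i, rfl⟩
        exact hbij.mapsTo ((hpC _).2 ⟨i, rfl⟩)
    exact ⟨f ∘ p, ⟨E, hE, hfE⟩, (hfE r).1 hrE,
      fun i => (hf _ ((hpC _).2 ⟨i, rfl⟩)).imp_left Eq.symm⟩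

/-- In the subgraph induced by `S`, the only neighbour of `l` is `x`, and the only neighbours
of `x` are `l` and `y`. -/
structure IsPendantPair (G : SimpleGraph V) (S : Set V) (x l y : V) : Prop where
  stem_mem : x ∈ S
  leaf_mem : l ∈ S
  mem : y ∈ S
  adj_leaf : G.Adj x l
  adj : G.Adj x y
  ne : l ≠ y
  eq_of_adj_leaf : ∀ w ∈ S, G.Adj l w → w = x
  eq_of_adj_stem : ∀ w ∈ S, G.Adj x w → w = l ∨ w = y

namespace IsPendantPair

variable {S : Set V} {x l y : V} (h : IsPendantPair G S x l y)
include h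

theorem mem_diff : y ∈ S \ {x, l} :=
  ⟨h.mem, by simp [h.adj.ne.symm, h.ne.symm]⟩

theorem ncard_diff [Finite V] : (S \ {x, l}).ncard + 2 = S.ncard := by
  rw [← Set.ncard_pair h.adj_leaf.ne]
  exact Set.ncard_sdiff_add_ncard_of_subset
    (Set.insert_subset h.stem_mem (Set.singleton_subset_iff.2 h.leaf_mem))

theorem relaxedDefends_diff {κ : Type*} (hS : RelaxedDefends G S (Option κ)) :
    RelaxedDefends G (S \ {x, l}) κ := by
  classical
  obtain ⟨F, ⟨p₀, hp₀⟩, hF⟩ := hS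
  let φ : V → V := fun v => if v = x ∨ v = l then y else v
  have hφ : ∀ v ∈ S, φ v ∈ S \ {x, l} := by
    intro v hv
    by_cases hvx : v = x ∨ v = l
    · simpa only [φ, if_pos hvx] using h.mem_diff
    · rw [show φ v = v from if_neg hvx]
      exact ⟨hv, by simpa using hvx⟩
  have hend : ∀ v, v = x ∨ v = l → φ v = y := fun v hv => if_pos hv
  have hnear : ∀ v w, v ∈ S → (v = w ∨ G.Adj v w) → (w = x ∨ w = l) → φ v = y := by
    rintro v w hv (rfl | hvw) hw
    · exact hend _ hw
    rcases hw with rfl | rfl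
    · rcases h.eq_of_adj_stem v hv hvw.symm with rfl | rfl
      · exact hend _ (Or.inr rfl)
      · simp [φ]
    · exact hend _ (Or.inl (h.eq_of_adj_leaf v hv hvw.symm))
  have hadj : ∀ v ∈ S, ∀ w ∈ S, (v = w ∨ G.Adj v w) → (φ v = φ w ∨ G.Adj (φ v) (φ w)) := by
    intro v hv w hw hvw
    by_cases hw' : w = x ∨ w = l
    · exact Or.inl ((hnear v w hv hvw hw').trans (hend w hw').symm)
    by_cases hv' : v = x ∨ v = l
    · exact Or.inl ((hend v hv').trans
        (hnear w v hw (hvw.imp Eq.symm SimpleGraph.Adj.symm) hv').symm)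
    · simpa only [φ, if_neg hv', if_neg hw'] using hvw
  have hguard : ∀ p ∈ F, ∃ i, p i = x ∨ p i = l := by
    intro p hp
    obtain ⟨q, -, ⟨i, hi⟩, hm⟩ := (hF p hp).2 l h.leaf_mem
    refine ⟨i, ?_⟩
    rcases hm i with hpi | hpi
    · exact Or.inr (hpi.trans hi)
    · exact Or.inl (h.eq_of_adj_leaf _ ((hF p hp).1 i) (hi ▸ hpi.symm))
  refine ⟨{p | ∃ q ∈ F, ∃ e : Option κ ≃ Option κ, (q (e none) = x ∨ q (e none) = l) ∧
    ∀ i, p i = φ (q (e (some i)))}, ?_, ?_⟩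
  · obtain ⟨i, hi⟩ := hguard p₀ hp₀
    exact ⟨_, p₀, hp₀, Equiv.swap none i, by simpa using hi, fun i => rfl⟩
  rintro p' ⟨p, hp, e, he, hp'⟩
  refine ⟨fun i => hp' i ▸ hφ _ ((hF p hp).1 _), fun r hr => ?_⟩
  obtain ⟨q, hq, ⟨i, hi⟩, hm⟩ := (hF p hp).2 r hr.1
  obtain ⟨j, hj⟩ := hguard q hq
  let e' : Option κ ≃ Option κ := e.trans (Equiv.swap (e none) j)
  have he' : e' none = j := by simp [e']
  refine ⟨fun i => φ (q (e' (some i))), ⟨q, hq, e', by rwa [he'], fun i => rfl⟩, ?_, fun m => ?_⟩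
  · have hr' : ¬ (r = x ∨ r = l) := by simpa using hr.2
    obtain ⟨m, hm'⟩ : ∃ m, e' (some m) = i := by
      rcases hem : e'.symm i with _ | m
      · exact absurd (by rwa [← he', ← hem, e'.apply_symm_apply, hi] at hj) hr'
      · exact ⟨m, by rw [← hem, e'.apply_symm_apply]⟩
    exact ⟨m, by simp only [hm', hi, φ, if_neg hr']⟩
  · rw [hp' m]
    beta_reduce
    by_cases hmj : e (some m) = j
    · have h1 : e' (some m) = e none := by simp [e', hmj]
      have h2 : φ (p (e (some m))) = y := hnear _ _ ((hF p hp).1 _) (hm _) (by rwa [hmj])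
      have h3 : φ (q (e none)) = y :=
        hnear _ _ ((hF q hq).1 _) ((hm _).imp Eq.symm SimpleGraph.Adj.symm) he
      exact Or.inl (by rw [h1, h2, h3])
    · have h1 : e' (some m) = e (some m) := by
        simp only [e', Equiv.trans_apply]
        exact Equiv.swap_apply_of_ne_of_ne (fun h => by simpa using e.injective h) hmj
      rw [h1]
      exact hadj _ ((hF p hp).1 _) _ ((hF q hq).1 _) (hm _)

end IsPendantPair

end Strategies

section Reduction

variable {V : Type*} {G : SimpleGraph V}

theorem connected_induce_diff {S R : Set V} {z : V} (hS : (G.induce S).Connected) (hz : z ∈ S \ R)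
    (h : ∀ v ∈ S \ R, ∀ w ∈ S, w ∈ R → G.Adj v w → v = z) : (G.induce (S \ R)).Connected := by
  classical
  let φ : S → (S \ R : Set V) := fun v => if hv : (v : V) ∈ R then ⟨z, hz⟩ else ⟨v, v.2, hv⟩
  have hφ : ∀ v w : S, (G.induce S).Adj v w →
      (G.induce (S \ R)).Reachable (φ v) (φ w) := by
    intro v w hvw
    have hvw' : G.Adj v w := hvw
    by_cases hv : (v : V) ∈ R <;> by_cases hw : (w : V) ∈ R <;>
      simp only [φ, hv, hw, dite_true, dite_false]
    · exact SimpleGraph.Reachable.refl _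
    · simp only [h w ⟨w.2, hw⟩ v v.2 hv hvw'.symm]
      exact SimpleGraph.Reachable.refl _
    · simp only [h v ⟨v.2, hv⟩ w w.2 hw hvw']
      exact SimpleGraph.Reachable.refl _
    · exact SimpleGraph.Adj.reachable (G := G.induce (S \ R)) hvw'
  have hwalk : ∀ {v w : S}, (G.induce S).Walk v w →
      (G.induce (S \ R)).Reachable (φ v) (φ w) := by
    intro v w p
    induction p with
    | nil => exact SimpleGraph.Reachable.refl _
    | cons hadj _ ih => exact (hφ _ _ hadj).trans ih
  have : Nonempty (S \ R : Set V) := ⟨⟨z, hz⟩⟩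
  refine ⟨fun a b => ?_⟩
  obtain ⟨p⟩ := hS ⟨a, a.2.1⟩ ⟨b, b.2.1⟩
  have := hwalk p
  simpa only [φ, a.2.2, b.2.2, dite_false, Subtype.coe_eta] using this

theorem IsPendantPair.connected {S : Set V} {x l y : V} (h : IsPendantPair G S x l y)
    (hS : (G.induce S).Connected) : (G.induce (S \ {x, l})).Connected := by
  refine connected_induce_diff hS h.mem_diff ?_
  rintro v ⟨hv, hv'⟩ w hw (rfl | rfl) hvw
  · exact (h.eq_of_adj_stem v hv hvw.symm).resolve_left fun hvl => hv' (by simp [hvl])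
  · exact absurd (by simp [h.eq_of_adj_leaf v hv hvw.symm]) hv'

theorem exists_isPendantPair {S : Set V} {x l : S} (hx : IsExposedStem (G.induce S) x)
    (hw : IsWeakStem (G.induce S) x) (hxl : (G.induce S).Adj x l)
    (hl : IsLeaf (G.induce S) l) : ∃ y, IsPendantPair G S x l y := by
  have hl' := (isLeaf_iff_forall hxl.symm).1 hl
  obtain ⟨a, ha⟩ := Set.encard_eq_one.1 hw.2
  have hla : l = a := by
    have : l ∈ {l | (G.induce S).Adj x l ∧ IsLeaf (G.induce S) l} := ⟨hxl, hl⟩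
    rwa [ha] at this
  subst hla
  have hnl : ∀ z, (G.induce S).Adj x z → z ≠ l → ¬ IsLeaf (G.induce S) z := by
    intro z hz hzl hz'
    have : z ∈ {l | (G.induce S).Adj x l ∧ IsLeaf (G.induce S) l} := ⟨hz, hz'⟩
    rw [ha] at this
    exact hzl this
  have h1 : 1 < ((G.induce S).neighborSet x).encard :=
    lt_of_lt_of_le (by norm_num) hx.1.1
  obtain ⟨y, hxy, hyl⟩ := (Set.one_lt_encard_iff_nontrivial.1 h1).exists_ne l
  have hxy' : (G.induce S).Adj x y := hxy
  refine ⟨y, x.2, l.2, y.2, hxl, hxy', fun h => hyl (Subtype.ext h.symm),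
    fun w hw hlw => congrArg Subtype.val (hl' ⟨w, hw⟩ hlw), fun w hw hxw => ?_⟩
  by_cases hwl : w = l
  · exact Or.inl hwl
  · have hwl' : (⟨w, hw⟩ : S) ≠ l := fun h => hwl (congrArg Subtype.val h)
    exact Or.inr (congrArg Subtype.val (Set.encard_le_one_iff.1 hx.2 ⟨w, hw⟩ y
      ⟨hxw, hnl _ hxw hwl'⟩ ⟨hxy', hnl _ hxy' hyl⟩))

theorem exists_two_leaves_of_not_isWeakStem {W : Type*} {G : SimpleGraph W} {x : W}
    (hx : IsStem G x) (hw : ¬ IsWeakStem G x) :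
    ∃ a b, a ≠ b ∧ (G.Adj x a ∧ IsLeaf G a) ∧ G.Adj x b ∧ IsLeaf G b := by
  by_contra hne
  push Not at hne
  obtain ⟨l, hxl, hl⟩ := hx.2
  refine hw ⟨hx, Set.encard_eq_one.2 ⟨l, Set.ext fun z => ⟨fun hz => ?_, ?_⟩⟩⟩
  · by_contra hzl
    exact hne z l hzl hz hxl hl
  · rintro rfl
    exact ⟨hxl, hl⟩

theorem EWSStep.exists_isPendantPair {S S' : Set V} (h : EWSStep G S S') :
    ∃ x l y, IsPendantPair G S x l y ∧ S' = S \ {x, l} := by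
  obtain ⟨x, l, hx, hw | h3, hxl, hl, rfl⟩ := h
  · obtain ⟨y, hy⟩ := EternalDomination.exists_isPendantPair hx hw hxl hl
    exact ⟨x, l, y, hy, rfl⟩
  · have hl' := (isLeaf_iff_forall hxl.symm).1 hl
    have h1 : 1 < ((G.induce S).neighborSet x).encard := lt_of_lt_of_le (by norm_num) hx.1.1
    obtain ⟨y, hxy, hyl⟩ := (Set.one_lt_encard_iff_nontrivial.1 h1).exists_ne l
    have hxy' : (G.induce S).Adj x y := hxy
    have hyl' : (y : V) ≠ l := fun h => hyl (Subtype.ext h)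
    have hxl' : G.Adj x l := hxl
    have hxy'' : G.Adj x y := hxy'
    have hsub : ({(x : V), (l : V), (y : V)} : Set V) ⊆ S := by
      rintro _ (rfl | rfl | rfl) <;> exact Subtype.coe_prop _
    have hcard : ({(x : V), (l : V), (y : V)} : Set V).encard = 3 := by
      rw [Set.encard_insert_of_notMem (by simp [hxl'.ne, hxy''.ne]), Set.encard_pair hyl'.symm]
      norm_num
    have hS : ({(x : V), (l : V), (y : V)} : Set V) = S :=
      (Set.finite_of_encard_eq_coe (k := 3) (by rw [h3]; rfl)).eq_of_subset_of_encard_le' hsub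
        (by rw [hcard, h3])
    refine ⟨x, l, y, ⟨x.2, l.2, y.2, hxl', hxy'', hyl'.symm,
      fun w hw hlw => congrArg Subtype.val (hl' ⟨w, hw⟩ hlw), fun w hw hxw => ?_⟩, rfl⟩
    rw [← hS] at hw
    rcases hw with rfl | hw
    · exact absurd hxw (G.loopless.irrefl _)
    · exact hw

variable [Finite V]

theorem exists_defends (hG : G.IsAcyclic) {S : Set V} (hS : (G.induce S).Connected) :
    ∃ k, 2 * k ≤ S.ncard + 1 ∧ Defends G S k := by
  classical
  induction hn : S.ncard using Nat.strong_induction_on generalizing S with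
  | _ n ih =>
    subst hn
    have := Fintype.ofFinite S
    have hcard : Fintype.card S = S.ncard := by
      rw [← Nat.card_eq_fintype_card]; rfl
    obtain ⟨v, hv⟩ := hS.nonempty
    by_cases h3 : 3 ≤ S.ncard
    · obtain ⟨x, hx⟩ := exists_isExposedStem ⟨hS, hG.induce S⟩ (hcard ▸ h3)
      by_cases hw : IsWeakStem (G.induce S) x
      · obtain ⟨l, hxl, hl⟩ := hx.1.2
        obtain ⟨y, hy⟩ := exists_isPendantPair hx hw hxl hl
        have hd := hy.ncard_diff
        obtain ⟨k, hk, hdef⟩ := ih _ (by omega) (hy.connected hS) rfl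
        exact ⟨k + 1, by omega, hdef.add_edge hy.stem_mem hy.leaf_mem hy.adj_leaf⟩
      · obtain ⟨a, b, hab, ⟨hxa, ha⟩, hxb, hb⟩ := exists_two_leaves_of_not_isWeakStem hx.1 hw
        have hsub : ({(a : V), (b : V)} : Set V) ⊆ S := by
          rintro _ (rfl | rfl) <;> exact Subtype.coe_prop _
        have hd := Set.ncard_sdiff_add_ncard_of_subset hsub
        rw [Set.ncard_pair fun h => hab (Subtype.ext h)] at hd
        have hxa' : G.Adj x a := hxa
        have hxb' : G.Adj x b := hxb
        have hcon : (G.induce (S \ {(a : V), (b : V)})).Connected := by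
          refine connected_induce_diff (z := x) hS ⟨x.2, by simp [hxa'.ne, hxb'.ne]⟩ ?_
          rintro v ⟨hv, -⟩ w hw (rfl | rfl) hvw
          · exact congrArg Subtype.val ((isLeaf_iff_forall hxa.symm).1 ha ⟨v, hv⟩ hvw.symm)
          · exact congrArg Subtype.val ((isLeaf_iff_forall hxb.symm).1 hb ⟨v, hv⟩ hvw.symm)
        obtain ⟨k, hk, hdef⟩ := ih _ (by omega) hcon rfl
        refine ⟨k + 1, by omega, hdef.add_neighbors x.2 hsub (Set.insert_nonempty _ _) ?_⟩
        rintro _ (rfl | rfl) <;> assumption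
    · have hpos : 0 < S.ncard := (Set.ncard_pos S.toFinite).2 ⟨v, hv⟩
      refine ⟨1, by omega, defends_one_of_clique ⟨v, hv⟩ fun a ha b hb hab => ?_⟩
      by_contra hadj
      obtain ⟨c, hc⟩ : ∃ c, (G.induce S).Adj ⟨a, ha⟩ c := by
        obtain ⟨p⟩ := hS ⟨a, ha⟩ ⟨b, hb⟩
        cases p with
        | nil => exact absurd rfl hab
        | cons h _ => exact ⟨_, h⟩
      have hc' : G.Adj a c := hc
      have hcb : b ≠ c := by rintro rfl; exact hadj hc'
      have : ({a, b, (c : V)} : Set V).ncard ≤ S.ncard := Set.ncard_le_ncard (by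
        rintro _ (rfl | rfl | rfl) <;> first | assumption | exact Subtype.coe_prop _)
      rw [Set.ncard_insert_of_notMem (by simp [hab, hc'.ne]), Set.ncard_pair hcb] at this
      omega

theorem isK1OrK2_of_ncard_le_two {S : Set V} (hS : (G.induce S).Connected) (h : S.ncard ≤ 2) :
    IsK1OrK2 G S := by
  have iso : ∀ n, S.ncard = n → Nonempty (G.induce S ≃g (⊤ : SimpleGraph (Fin n))) := by
    intro n hn
    refine ⟨⟨Finite.equivFinOfCardEq hn, fun {a b} => ?_⟩⟩
    rw [SimpleGraph.top_adj, (Finite.equivFinOfCardEq hn).injective.ne_iff]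
    refine ⟨fun hab => ?_, SimpleGraph.Adj.ne⟩
    obtain ⟨p⟩ := hS a b
    cases p with
    | nil => exact absurd rfl hab
    | @cons _ c _ hc _ =>
      by_cases hcb : c = b
      · exact hcb ▸ hc
      have hc' : G.Adj a c := hc
      have : ({(a : V), (b : V), (c : V)} : Set V).ncard ≤ S.ncard := Set.ncard_le_ncard (by
        rintro _ (rfl | rfl | rfl) <;> exact Subtype.coe_prop _)
      rw [Set.ncard_insert_of_notMem (by simp [Subtype.coe_injective.ne hab, hc'.ne]),
        Set.ncard_pair fun h => hcb (Subtype.ext h).symm] at this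
      omega
  have hpos : 0 < S.ncard :=
    (Set.ncard_pos S.toFinite).2 (Set.nonempty_coe_sort.1 hS.nonempty)
  obtain h1 | h2 : S.ncard = 1 ∨ S.ncard = 2 := by omega
  exacts [Or.inl (iso 1 h1), Or.inr (iso 2 h2)]

omit [Finite V] in
theorem IsK1OrK2.ncard_le_two {S : Set V} (h : IsK1OrK2 G S) :
    S.Nonempty ∧ S.ncard ≤ 2 ∧ ∀ a ∈ S, ∀ b ∈ S, a ≠ b → G.Adj a b := by
  have key : ∀ n, Nonempty (G.induce S ≃g (⊤ : SimpleGraph (Fin n))) →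
      S.ncard = n ∧ ∀ a ∈ S, ∀ b ∈ S, a ≠ b → G.Adj a b := by
    rintro n ⟨e⟩
    refine ⟨?_, fun a ha b hb hab => ?_⟩
    · have := Nat.card_congr e.toEquiv
      rwa [Nat.card_fin] at this
    · have : (G.induce S).Adj ⟨a, ha⟩ ⟨b, hb⟩ := by
        rw [← e.map_adj_iff, SimpleGraph.top_adj]
        exact e.injective.ne fun h => hab (congrArg Subtype.val h)
      exact this
  rcases h with h | h <;> obtain ⟨h1, h2⟩ := key _ h <;>
    exact ⟨Set.nonempty_of_ncard_ne_zero (by omega), by omega, h2⟩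

theorem ncard_le_of_reduces {S₀ S : Set V} (h : Relation.ReflTransGen (EWSStep G) S₀ S)
    (hS : IsK1OrK2 G S) : ∀ k, RelaxedDefends G S₀ (Fin k) → S₀.ncard ≤ 2 * k := by
  induction h using Relation.ReflTransGen.head_induction_on with
  | refl =>
    intro k hk
    obtain ⟨h1, h2, -⟩ := hS.ncard_le_two
    have := Fin.pos_iff_nonempty.2 (hk.nonempty h1)
    omega
  | head hstep _ ih =>
    intro k hk
    obtain ⟨x, l, y, hp, rfl⟩ := hstep.exists_isPendantPair
    have hpos := Fin.pos_iff_nonempty.2 (hk.nonempty ⟨x, hp.stem_mem⟩)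
    obtain ⟨k, rfl⟩ := Nat.exists_eq_succ_of_ne_zero hpos.ne'
    have := ih k (hp.relaxedDefends_diff (hk.congr (finSuccEquiv k).symm))
    have := hp.ncard_diff
    omega

theorem card_indepSet_le_of_reduces {S₀ S : Set V}
    (h : Relation.ReflTransGen (EWSStep G) S₀ S) (hS : IsK1OrK2 G S) :
    ∀ I ⊆ S₀, (∀ a ∈ I, ∀ b ∈ I, ¬ G.Adj a b) → 2 * I.ncard ≤ S₀.ncard + 1 := by
  induction h using Relation.ReflTransGen.head_induction_on with
  | refl =>
    intro I hI hind
    obtain ⟨h1, h2, h3⟩ := hS.ncard_le_two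
    have h4 : I.ncard ≤ 1 := by
      rw [Set.ncard_le_one_iff]
      intro a b ha hb
      by_contra hab
      exact hind a ha b hb (h3 a (hI ha) b (hI hb) hab)
    have h5 := (Set.ncard_pos (Set.toFinite _)).2 h1
    omega
  | head hstep _ ih =>
    intro I hI hind
    obtain ⟨x, l, y, hp, rfl⟩ := hstep.exists_isPendantPair
    have h1 := ih (I \ {x, l}) (Set.sdiff_subset_sdiff_left hI)
      fun a ha b hb => hind a ha.1 b hb.1
    have h2 := hp.ncard_diff
    have h3 : (I ∩ {x, l}).ncard ≤ 1 := by
      rw [Set.ncard_le_one_iff]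
      rintro a b ⟨ha, rfl | rfl⟩ ⟨hb, rfl | rfl⟩
      exacts [rfl, absurd hp.adj_leaf (hind _ ha _ hb),
        absurd hp.adj_leaf (hind _ hb _ ha), rfl]
    have h4 := Set.ncard_inter_add_ncard_sdiff_eq_ncard I {x, l}
    omega

theorem exists_indepSet_of_reduces {S₀ S : Set V}
    (h : Relation.ReflTransGen (EWSStep G) S₀ S)
    (hS : ∃ I ⊆ S, (∀ a ∈ I, ∀ b ∈ I, ¬ G.Adj a b) ∧ S.ncard + 2 ≤ 2 * I.ncard) :
    ∃ I ⊆ S₀, (∀ a ∈ I, ∀ b ∈ I, ¬ G.Adj a b) ∧ S₀.ncard + 2 ≤ 2 * I.ncard := by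
  induction h using Relation.ReflTransGen.head_induction_on with
  | refl => exact hS
  | head hstep _ ih =>
    obtain ⟨x, l, y, hp, rfl⟩ := hstep.exists_isPendantPair
    obtain ⟨I, hI, hind, hc⟩ := ih
    have hl : l ∉ I := fun h => (hI h).2 (by simp)
    have hlI : ∀ a ∈ I, ¬ G.Adj l a := fun a ha hla =>
      (hI ha).2 (by simp [hp.eq_of_adj_leaf a (hI ha).1 hla])
    refine ⟨insert l I, Set.insert_subset hp.leaf_mem (hI.trans Set.sdiff_subset), ?_, ?_⟩
    · rintro a (rfl | ha) b (rfl | hb)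
      exacts [G.loopless.irrefl _, hlI b hb, fun h => hlI a ha h.symm, hind a ha b hb]
    · have := hp.ncard_diff
      rw [Set.ncard_insert_of_notMem hl]
      omega

omit [Finite V] in
theorem connected_of_reduces {S₀ S : Set V} (h : Relation.ReflTransGen (EWSStep G) S₀ S)
    (hS : (G.induce S₀).Connected) : (G.induce S).Connected := by
  induction h with
  | refl => exact hS
  | tail _ hstep ih =>
    obtain ⟨x, l, y, hp, rfl⟩ := hstep.exists_isPendantPair
    exact hp.connected ih

theorem exists_terminal (S₀ : Set V) :
    ∃ S, Relation.ReflTransGen (EWSStep G) S₀ S ∧ ∀ S', ¬ EWSStep G S S' := by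
  induction hn : S₀.ncard using Nat.strong_induction_on generalizing S₀ with
  | _ n ih =>
    by_cases h : ∃ S', EWSStep G S₀ S'
    · obtain ⟨S', hS'⟩ := h
      obtain ⟨x, l, y, hp, hS⟩ := hS'.exists_isPendantPair
      have := hp.ncard_diff
      rw [← hS] at this
      obtain ⟨S, h1, h2⟩ := ih _ (by omega) S' rfl
      exact ⟨S, h1.head hS', h2⟩
    · exact ⟨S₀, Relation.ReflTransGen.refl, not_exists.1 h⟩

theorem exists_large_indepSet_of_terminal (hG : G.IsAcyclic) {S : Set V}
    (hS : (G.induce S).Connected) (hterm : ∀ S', ¬ EWSStep G S S') (h3 : 3 ≤ S.ncard) :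
    ∃ I ⊆ S, (∀ a ∈ I, ∀ b ∈ I, ¬ G.Adj a b) ∧ S.ncard + 2 ≤ 2 * I.ncard := by
  have := Fintype.ofFinite S
  have hcard : Fintype.card S = S.ncard := by
    rw [← Nat.card_eq_fintype_card]; rfl
  have htree : (G.induce S).IsTree := ⟨hS, hG.induce S⟩
  have hweak : ∀ x, IsExposedStem (G.induce S) x →
      ¬ (IsWeakStem (G.induce S) x ∨ S.encard = 3) := by
    intro x hx hw
    obtain ⟨l, hxl, hl⟩ := hx.1.2
    exact hterm _ ⟨x, l, hx, hw, hxl, hl, rfl⟩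
  have h4 : 4 ≤ Fintype.card S := by
    rw [hcard]
    refine lt_of_le_of_ne h3 fun h => ?_
    obtain ⟨x, hx⟩ := exists_isExposedStem htree (hcard ▸ h3)
    refine hweak x hx (Or.inr ?_)
    rw [← S.toFinite.cast_ncard_eq, ← h]
    rfl
  obtain ⟨I, hI, hIc⟩ := exists_large_indepSet htree h4 fun x hx =>
    exists_two_leaves_of_not_isWeakStem hx.1 fun h => hweak x hx (Or.inl h)
  refine ⟨Subtype.val '' (I : Set S), Subtype.coe_image_subset _ _, ?_, ?_⟩
  · rintro _ ⟨a, ha, rfl⟩ _ ⟨b, hb, rfl⟩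
    exact hI a ha b hb
  · rw [Set.ncard_image_of_injective _ Subtype.coe_injective, Set.ncard_coe_finset, ← hcard]
    exact hIc

end Reduction

section Numbers

variable {V : Type*} [Fintype V] {G : SimpleGraph V}

theorem ncard_le_indepNum {I : Set V} (h : ∀ a ∈ I, ∀ b ∈ I, ¬ G.Adj a b) :
    I.ncard ≤ G.indepNum := by
  classical
  rw [Set.ncard_eq_toFinset_card']
  refine SimpleGraph.IsIndepSet.card_le_indepNum ?_
  rw [Set.coe_toFinset]
  exact fun a ha b hb _ => h a ha b hb

omit [Fintype V] in
theorem exists_indepSet_ncard_eq (G : SimpleGraph V) :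
    ∃ I : Set V, (∀ a ∈ I, ∀ b ∈ I, ¬ G.Adj a b) ∧ I.ncard = G.indepNum := by
  obtain ⟨I, hI, hc⟩ := G.exists_isNIndepSet_indepNum
  refine ⟨I, fun a ha b hb hab => hI ha hb hab.ne hab, by rw [Set.ncard_coe_finset, hc]⟩

theorem card_le_two_mul_indepNum (hG : G.IsTree) : Fintype.card V ≤ 2 * G.indepNum := by
  classical
  obtain ⟨J, -, hJ, hc⟩ := exists_indepSet_card_le hG.colorable_two Finset.univ
  have := ncard_le_indepNum (I := (J : Set V)) hJ
  rw [Set.ncard_coe_finset] at this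
  rw [Finset.card_univ] at hc
  omega

theorem ncard_univ_eq : (Set.univ : Set V).ncard = Fintype.card V := by
  rw [Set.ncard_univ, Nat.card_eq_fintype_card]

omit [Fintype V] in
theorem connected_induce_univ (hG : G.Connected) : (G.induce Set.univ).Connected :=
  (SimpleGraph.induceUnivIso G).connected_iff.2 hG

theorem two_mul_mEternalDominationNumber_le (hG : G.IsTree) :
    2 * mEternalDominationNumber G ≤ Fintype.card V + 1 := by
  obtain ⟨k, hk, hdef⟩ := exists_defends hG.isAcyclic (connected_induce_univ hG.connected)
  rw [ncard_univ_eq] at hk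
  have : mEternalDominationNumber G ≤ k := Nat.sInf_le hdef.exists_isMEternalDominating
  omega

theorem card_le_two_mul_mEternalDominationNumber (hG : G.IsTree) {S : Set V}
    (h : EWSReducesTo G S) (hS : IsK1OrK2 G S) :
    Fintype.card V ≤ 2 * mEternalDominationNumber G := by
  obtain ⟨k, -, hdef⟩ := exists_defends hG.isAcyclic (connected_induce_univ hG.connected)
  obtain ⟨D, hD, hc⟩ := Nat.sInf_mem
    (s := {k : ℕ | ∃ D : Finset V, IsMEternalDominating G D ∧ D.card = k})
    ⟨k, hdef.exists_isMEternalDominating⟩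
  have := ncard_le_of_reduces h hS _ hD.relaxedDefends
  rwa [ncard_univ_eq, hc] at this

theorem mEternalDominationNumber_eq_indepNum_of_reduces (hG : G.IsTree) {S : Set V}
    (h : EWSReducesTo G S) (hS : IsK1OrK2 G S) : mEternalDominationNumber G = G.indepNum := by
  have h1 := two_mul_mEternalDominationNumber_le hG
  have h2 := card_le_two_mul_mEternalDominationNumber hG h hS
  have h3 := card_le_two_mul_indepNum hG
  obtain ⟨I, hI, hc⟩ := exists_indepSet_ncard_eq G
  have h4 := card_indepSet_le_of_reduces h hS I (Set.subset_univ I) hI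
  rw [ncard_univ_eq] at h4
  omega

theorem isK1OrK2_of_mEternalDominationNumber_eq (hG : G.IsTree)
    (heq : mEternalDominationNumber G = G.indepNum) {S : Set V} (h : EWSReducesTo G S)
    (hterm : ∀ S', ¬ EWSStep G S S') : IsK1OrK2 G S := by
  have hS := connected_of_reduces h (connected_induce_univ hG.connected)
  refine isK1OrK2_of_ncard_le_two hS ?_
  by_contra h3
  obtain ⟨I, -, hI, hc⟩ := exists_indepSet_of_reduces h
    (exists_large_indepSet_of_terminal hG.isAcyclic hS hterm (by omega))
  have h1 := two_mul_mEternalDominationNumber_le hG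
  have h2 := ncard_le_indepNum hI
  rw [ncard_univ_eq] at hc
  omega

end Numbers

end EternalDomination
theorem theorem6p6 {V : Type*} [Fintype V] (T : SimpleGraph V) (hT : T.IsTree)
    (hV : 2 ≤ Fintype.card V) :
    (EternalDomination.mEternalDominationNumber T = T.indepNum ↔
      ∃ S : Set V, EternalDomination.EWSReducesTo T S ∧ EternalDomination.IsK1OrK2 T S) ∧
    (EternalDomination.mEternalDominationNumber T = T.indepNum ↔
      ∀ S : Set V, EternalDomination.EWSReducesTo T S →
        (∀ S' : Set V, ¬ EternalDomination.EWSStep T S S') → EternalDomination.IsK1OrK2 T S) := by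
  obtain ⟨S₀, hred, hterm⟩ := EternalDomination.exists_terminal (G := T) Set.univ
  refine ⟨⟨fun h => ⟨S₀, hred, ?_⟩, ?_⟩, ⟨fun h S hS hS' => ?_, fun h => ?_⟩⟩
  · exact EternalDomination.isK1OrK2_of_mEternalDominationNumber_eq hT h hred hterm
  · rintro ⟨S, hS, hK⟩
    exact EternalDomination.mEternalDominationNumber_eq_indepNum_of_reduces hT hS hK
  · exact EternalDomination.isK1OrK2_of_mEternalDominationNumber_eq hT h hS hS'
  · exact EternalDomination.mEternalDominationNumber_eq_indepNum_of_reduces hT hred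
      (h S₀ hred hterm)
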